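/- Let $N\ge 0$ (with $0^0=1$) and let $E=\{1,\dots,N\}^2$. For an $N\times N$ real matrix $\beta=(\beta_i^j)$ let $\beta.*(1-\beta)$ be the matrix with entries $\beta_i^j(1-\beta_i^j)$. Given $p_i^j\ge 0$ for $(i,j)\in E$ and a temperature $T>0$, call $\beta$ a BP (belief propagation) belief matrix if it is doubly stochastic (non-negative entries, all row and column sums equal to $1$) and there are real numbers $\mu_1,\dots,\mu_N$ and $\mu^1,\dots,\mu^N$ such that $$\beta_i^j(1-\beta_i^j)=(p_i^j)^{1/T}\exp(\mu_i+\mu^j)\qquad\text{for all }(i,j)\in E .$$ Then every BP belief matrix $\beta$, and more generally every doubly stochastic $N\times N$ matrix $\beta$, satisfies $$\operatorname{Perm}\bigl(\beta.*(1-\beta)\bigr)\;\ge\;\frac{N!}{N^N}\prod_{(i,j)\in E}(1-\beta_i^j)^{\beta_i^j}.$$ -/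

import Mathlib

open scoped Nat

/-- The entrywise product `β .* (1 - β)`, whose `(i, j)` entry is `β i j * (1 - β i j)`
(here `1` stands for the all-ones matrix, not for the identity matrix). -/
def beliefVariance {N : ℕ} (β : Matrix (Fin N) (Fin N) ℝ) : Matrix (Fin N) (Fin N) ℝ :=
  Matrix.of fun i j => β i j * (1 - β i j)

/-- `β` is a belief propagation (BP) belief matrix for the perfect matching model on `K_{N,N}` with
edge weights `(p i j) ^ (1 / T)`: it is doubly stochastic and it solves, for some Lagrange
multipliers `μ` (rows) and `ν` (columns), the stationarity equations of the Bethe free energy. -/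
structure IsBPBelief {N : ℕ} (p : Matrix (Fin N) (Fin N) ℝ) (T : ℝ)
    (β : Matrix (Fin N) (Fin N) ℝ) : Prop where
  doublyStochastic : β ∈ doublyStochastic ℝ (Fin N)
  stationary : ∃ μ ν : Fin N → ℝ, ∀ i j,
    β i j * (1 - β i j) = p i j ^ (1 / T) * Real.exp (μ i + ν j)

/-! Weighted AM-GM, with the rows of `β` as weights, bounds the capacity inf ∏ᵢ(Ax)ᵢ / ∏ⱼxⱼ of A =
β.*(1-β) below by ∏(1-β)^β; Gurvits' inequality Perm A ≥ N!/N^N · cap A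
(`Matrix.capacity_le_permanent`) then finishes. For the latter, differentiate ∏ vᵢ along the columns
of A one at a time until the permanent remains. For positive columns, f / D_c f is superadditive and
homogeneous of degree one, hence concave (`div_cons_superadditive`). So f grows along a positive
line at most like a power of its linearisation, and a derivative taken at degree m costs only a
factor ((m-1)/m)^(m-1) of capacity; these factors telescope to N!/N^N. -/

/-- The weighted harmonic sum is superadditive. -/
theorem inv_sum_div_superadditive {ι : Type*} (s : Finset ι) (hs : s.Nonempty) (c a b h : ι → ℝ)
    (hc : ∀ j ∈ s, 0 < c j) (ha : ∀ j ∈ s, 0 < a j) (hb : ∀ j ∈ s, 0 < b j)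
    (hh : ∀ j ∈ s, a j + b j ≤ h j) :
    (∑ j ∈ s, c j / a j)⁻¹ + (∑ j ∈ s, c j / b j)⁻¹ ≤ (∑ j ∈ s, c j / h j)⁻¹ := by
  set A := ∑ j ∈ s, c j / a j
  set B := ∑ j ∈ s, c j / b j
  have hA : 0 < A := Finset.sum_pos (fun j hj => div_pos (hc j hj) (ha j hj)) hs
  have hB : 0 < B := Finset.sum_pos (fun j hj => div_pos (hc j hj) (hb j hj)) hs
  have hH : 0 < ∑ j ∈ s, c j / h j := Finset.sum_pos
    (fun j hj => div_pos (hc j hj) (by linarith [ha j hj, hb j hj, hh j hj])) hs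
  -- Termwise c/(a+b) ≤ λ²c/a + (1-λ)²c/b for every λ; λ = B/(A+B) minimises the sum of the right
  -- sides.
  have hle : ∑ j ∈ s, c j / h j ≤ (B / (A + B)) ^ 2 * A + (A / (A + B)) ^ 2 * B := by
    simp only [A, B, Finset.mul_sum]
    rw [← Finset.sum_add_distrib]
    refine Finset.sum_le_sum fun j hj => ?_
    have ha' := ha j hj
    have hb' := hb j hj
    have hc' := hc j hj
    calc c j / h j ≤ c j / (a j + b j) :=
          div_le_div_of_nonneg_left hc'.le (by positivity) (hh j hj)
      _ ≤ _ := by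
        change _ ≤ (B / (A + B)) ^ 2 * (c j / a j) + (A / (A + B)) ^ 2 * (c j / b j)
        have e : (B / (A + B)) ^ 2 * (c j / a j) + (A / (A + B)) ^ 2 * (c j / b j)
            - c j / (a j + b j)
            = c j * (B * b j - A * a j) ^ 2 / ((A + B) ^ 2 * a j * b j * (a j + b j)) := by
          field_simp
          ring
        have : 0 ≤ c j * (B * b j - A * a j) ^ 2 / ((A + B) ^ 2 * a j * b j * (a j + b j)) := by
          positivity
        linarith
  have e : (B / (A + B)) ^ 2 * A + (A / (A + B)) ^ 2 * B = (A⁻¹ + B⁻¹)⁻¹ := by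
    field_simp
    ring
  rw [e] at hle
  exact (le_inv_comm₀ hH (by positivity)).mp hle

/-! ### Mixed derivatives of a monomial -/

/-- The iterated directional derivative, along the vectors of the list, of the monomial
`∏ i ∈ R, v i`, evaluated at `v`. -/
def mixedDeriv {ι : Type*} [DecidableEq ι] : List (ι → ℝ) → Finset ι → (ι → ℝ) → ℝ
  | [], R, v => ∏ i ∈ R, v i
  | c :: L, R, v => ∑ i ∈ R, c i * mixedDeriv L (R.erase i) v

namespace mixedDeriv

variable {ι : Type*} [DecidableEq ι]

theorem nil (R : Finset ι) (v : ι → ℝ) : mixedDeriv [] R v = ∏ i ∈ R, v i := rfl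

theorem cons (c : ι → ℝ) (L : List (ι → ℝ)) (R : Finset ι) (v : ι → ℝ) :
    mixedDeriv (c :: L) R v = ∑ i ∈ R, c i * mixedDeriv L (R.erase i) v := rfl

theorem sum_erase_comm (R : Finset ι) (f : ι → ι → ℝ) :
    ∑ i ∈ R, ∑ j ∈ R.erase i, f i j = ∑ j ∈ R, ∑ i ∈ R.erase j, f i j := by
  refine Finset.sum_comm' ?_
  intro x y
  simp only [Finset.mem_erase]
  tauto

theorem cons_cons_comm (c d : ι → ℝ) (L : List (ι → ℝ)) (R : Finset ι) (v : ι → ℝ) :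
    mixedDeriv (c :: d :: L) R v = mixedDeriv (d :: c :: L) R v := by
  simp only [cons, Finset.mul_sum]
  rw [sum_erase_comm]
  refine Finset.sum_congr rfl fun i _ => Finset.sum_congr rfl fun j _ => ?_
  rw [Finset.erase_right_comm]
  ring

theorem perm {L L' : List (ι → ℝ)} (h : L.Perm L') (R : Finset ι) (v : ι → ℝ) :
    mixedDeriv L R v = mixedDeriv L' R v := by
  induction h generalizing R with
  | nil => rfl
  | cons c _ ih => simp only [cons, ih]
  | swap c d L => exact cons_cons_comm _ _ _ _ _
  | trans _ _ ih₁ ih₂ => rw [ih₁, ih₂]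

theorem eq_zero_of_card_lt (L : List (ι → ℝ)) (R : Finset ι) (v : ι → ℝ)
    (h : R.card < L.length) : mixedDeriv L R v = 0 := by
  induction L generalizing R with
  | nil => simp at h
  | cons c L ih =>
    refine Finset.sum_eq_zero fun i hi => ?_
    rw [ih, mul_zero]
    have := Finset.card_erase_add_one hi
    simp only [List.length_cons] at h
    omega

/-- The degree in `v` is `R.card - L.length`, so nothing depends on `v` once the list is long
enough. -/
theorem congr_of_card_le (L : List (ι → ℝ)) (R : Finset ι) (v w : ι → ℝ)
    (h : R.card ≤ L.length) : mixedDeriv L R v = mixedDeriv L R w := by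
  induction L generalizing R with
  | nil =>
    have : R = ∅ := by simpa using h
    simp [this, nil]
  | cons c L ih =>
    refine Finset.sum_congr rfl fun i hi => ?_
    rw [ih]
    have := Finset.card_erase_add_one hi
    simp only [List.length_cons] at h
    omega

theorem pos (L : List (ι → ℝ)) (hL : ∀ c ∈ L, ∀ i, 0 < c i) (R : Finset ι) (v : ι → ℝ)
    (hv : ∀ i, 0 < v i) (h : L.length ≤ R.card) : 0 < mixedDeriv L R v := by
  induction L generalizing R with
  | nil => exact Finset.prod_pos fun i _ => hv i
  | cons c L ih =>
    simp only [List.length_cons] at h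
    refine Finset.sum_pos (fun i hi => ?_) (Finset.card_pos.mp (by omega))
    have := Finset.card_erase_add_one hi
    exact mul_pos (hL c (by simp) i)
      (ih (fun d hd => hL d (by simp [hd])) _ (by omega))

/-- Expansion of a mixed derivative along a row. -/
theorem expand_row (L : List (ι → ℝ)) (R : Finset ι) (v : ι → ℝ) (i : ι) (hi : i ∈ R) :
    mixedDeriv L R v = v i * mixedDeriv L (R.erase i) v
      + ∑ l : Fin L.length, L[l] i * mixedDeriv (L.eraseIdx l) (R.erase i) v := by
  induction L generalizing R with
  | nil => simp [nil, Finset.mul_prod_erase R v hi]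
  | cons c L ih =>
    have key : ∀ j ∈ R.erase i, c j * mixedDeriv L (R.erase j) v =
        v i * (c j * mixedDeriv L ((R.erase i).erase j) v) +
        ∑ l : Fin L.length,
          L[l] i * (c j * mixedDeriv (L.eraseIdx l) ((R.erase i).erase j) v) := by
      intro j hj
      rw [ih (R.erase j) (Finset.mem_erase.mpr ⟨(Finset.ne_of_mem_erase hj).symm, hi⟩),
        Finset.erase_right_comm, mul_add, Finset.mul_sum]
      congr 1
      · ring
      · exact Finset.sum_congr rfl fun l _ => by ring
    have hsucc : ∑ l : Fin (c :: L).length,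
        (c :: L)[l] i * mixedDeriv ((c :: L).eraseIdx l) (R.erase i) v =
        c i * mixedDeriv L (R.erase i) v + ∑ l : Fin L.length,
          L[l] i * mixedDeriv (c :: L.eraseIdx l) (R.erase i) v :=
      Fin.sum_univ_succ (n := L.length)
        (fun l => (c :: L)[l] i * mixedDeriv ((c :: L).eraseIdx l) (R.erase i) v)
    rw [hsucc, cons, ← Finset.add_sum_erase _ _ hi, Finset.sum_congr rfl key,
      Finset.sum_add_distrib, ← Finset.mul_sum, Finset.sum_comm]
    simp only [← Finset.mul_sum, cons]
    ring

/-- Euler's identity for the homogeneous polynomial `mixedDeriv L R`. -/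
theorem cons_self (L : List (ι → ℝ)) (R : Finset ι) (v : ι → ℝ) :
    mixedDeriv (v :: L) R v = ((R.card : ℝ) - L.length) * mixedDeriv L R v := by
  induction L generalizing R with
  | nil =>
    simp only [cons, nil, List.length_nil, Nat.cast_zero, sub_zero]
    rw [Finset.sum_congr rfl fun i hi => Finset.mul_prod_erase R v hi]
    simp
  | cons c L ih =>
    rw [cons_cons_comm, cons, cons, Finset.mul_sum]
    refine Finset.sum_congr rfl fun i hi => ?_
    have := Finset.card_erase_add_one hi
    rw [ih, ← this]
    push_cast [List.length_cons]
    ring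

theorem hasDerivAt (L : List (ι → ℝ)) (R : Finset ι) (w a : ι → ℝ) (t : ℝ) :
    HasDerivAt (fun t : ℝ => mixedDeriv L R (w + t • a)) (mixedDeriv (a :: L) R (w + t • a)) t := by
  induction L generalizing R with
  | nil =>
    have h : ∀ i ∈ R, HasDerivAt (fun t : ℝ => (w + t • a) i) (a i) t := fun i _ => by
      simpa using ((hasDerivAt_id t).mul_const (a i)).const_add (w i)
    refine (HasDerivAt.fun_finsetProd h).congr_deriv ?_
    simp only [cons, nil, smul_eq_mul]
    exact Finset.sum_congr rfl fun i _ => by ring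
  | cons c L ih =>
    rw [cons_cons_comm]
    exact HasDerivAt.fun_sum fun i _ => (ih (R.erase i)).const_mul (c i)

/-! ### Superadditivity of f / D_c f -/

/-- If all quotients of `mixedDeriv L R` by its partial derivatives are superadditive, so are the
quotients by its positive directional derivatives. -/
theorem div_cons_superadditive_of (R : Finset ι) (L : List (ι → ℝ)) (hL : ∀ c ∈ L, ∀ i, 0 < c i)
    (c v w : ι → ℝ) (hc : ∀ i, 0 < c i) (hv : ∀ i, 0 < v i) (hw : ∀ i, 0 < w i)
    (H : ∀ j ∈ R, mixedDeriv L R v / mixedDeriv L (R.erase j) v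
      + mixedDeriv L R w / mixedDeriv L (R.erase j) w
      ≤ mixedDeriv L R (v + w) / mixedDeriv L (R.erase j) (v + w)) :
    mixedDeriv L R v / mixedDeriv (c :: L) R v + mixedDeriv L R w / mixedDeriv (c :: L) R w
      ≤ mixedDeriv L R (v + w) / mixedDeriv (c :: L) R (v + w) := by
  rcases lt_or_ge R.card (c :: L).length with h | h
  · simp [eq_zero_of_card_lt _ _ _ h]
  have hvw : ∀ i, 0 < (v + w) i := fun i => add_pos (hv i) (hw i)
  simp only [List.length_cons] at h
  have hR : R.Nonempty := Finset.card_pos.mp (by omega)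
  have hpos : ∀ u : ι → ℝ, (∀ i, 0 < u i) → ∀ j ∈ R,
      0 < mixedDeriv L R u / mixedDeriv L (R.erase j) u := by
    intro u hu j hj
    have := Finset.card_erase_add_one hj
    exact div_pos (pos L hL R u hu (by omega)) (pos L hL _ u hu (by omega))
  have heq : ∀ u : ι → ℝ, (∀ i, 0 < u i) → mixedDeriv L R u / mixedDeriv (c :: L) R u =
      (∑ j ∈ R, c j / (mixedDeriv L R u / mixedDeriv L (R.erase j) u))⁻¹ := by
    intro u _
    rw [← inv_div, cons, Finset.sum_div]
    congr 1
    exact Finset.sum_congr rfl fun j _ => by rw [div_div_eq_mul_div]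
  rw [heq v hv, heq w hw, heq _ hvw]
  exact inv_sum_div_superadditive R hR _ _ _ _ (fun j _ => hc j) (hpos v hv) (hpos w hw) H

/-- Erasing `i` is ∂ᵢ. Row expansion turns f / ∂ᵢf into `v i` plus a positive combination of
quotients g / D_c g on one coordinate fewer, so induction applies. -/
theorem div_erase_superadditive (R : Finset ι) (L : List (ι → ℝ)) (hL : ∀ c ∈ L, ∀ i, 0 < c i)
    (i : ι) (hi : i ∈ R) (v w : ι → ℝ) (hv : ∀ i, 0 < v i) (hw : ∀ i, 0 < w i) :
    mixedDeriv L R v / mixedDeriv L (R.erase i) v + mixedDeriv L R w / mixedDeriv L (R.erase i) w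
      ≤ mixedDeriv L R (v + w) / mixedDeriv L (R.erase i) (v + w) := by
  induction hn : R.card generalizing R L i with
  | zero => simp_all
  | succ n ih =>
    have hcard := Finset.card_erase_add_one hi
    -- Here the denominators vanish, and `x / 0 = 0` makes the claim trivial.
    rcases lt_or_ge (R.erase i).card L.length with h | h
    · simp [eq_zero_of_card_lt _ _ _ h]
    have hvw : ∀ i, 0 < (v + w) i := fun i => add_pos (hv i) (hw i)
    have heq : ∀ u : ι → ℝ, (∀ i, 0 < u i) → mixedDeriv L R u / mixedDeriv L (R.erase i) u =
        u i + ∑ l : Fin L.length, L[l] i *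
          (mixedDeriv (L.eraseIdx l) (R.erase i) u / mixedDeriv L (R.erase i) u) := by
      intro u hu
      have h0 := (pos L hL (R.erase i) u hu h).ne'
      rw [expand_row L R u i hi, add_div, mul_div_cancel_right₀ _ h0, Finset.sum_div]
      simp only [mul_div_assoc]
    rw [heq v hv, heq w hw, heq _ hvw, Pi.add_apply, add_add_add_comm, ← Finset.sum_add_distrib]
    refine add_le_add le_rfl (Finset.sum_le_sum fun l _ => ?_)
    rw [← mul_add]
    refine mul_le_mul_of_nonneg_left ?_ (hL _ (List.getElem_mem _) i).le
    have hp : (L[l] :: L.eraseIdx l).Perm L := List.getElem_cons_eraseIdx_perm l.2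
    have hL' : ∀ c ∈ L.eraseIdx l, ∀ i, 0 < c i :=
      fun c hc => hL c (List.mem_of_mem_eraseIdx hc)
    have := div_cons_superadditive_of (R.erase i) (L.eraseIdx l) hL' L[l] v w
      (hL _ (List.getElem_mem _)) hv hw
      fun j hj => ih (R.erase i) (L.eraseIdx l) hL' j hj (by omega)
    simpa only [perm hp] using this

theorem div_cons_superadditive (R : Finset ι) (L : List (ι → ℝ)) (hL : ∀ c ∈ L, ∀ i, 0 < c i)
    (c v w : ι → ℝ) (hc : ∀ i, 0 < c i) (hv : ∀ i, 0 < v i) (hw : ∀ i, 0 < w i) :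
    mixedDeriv L R v / mixedDeriv (c :: L) R v + mixedDeriv L R w / mixedDeriv (c :: L) R w
      ≤ mixedDeriv L R (v + w) / mixedDeriv (c :: L) R (v + w) :=
  div_cons_superadditive_of R L hL c v w hc hv hw
    fun j hj => div_erase_superadditive R L hL j hj v w hv hw

/-! ### Growth along lines and capacity -/

/-- Along a positive line, `mixedDeriv L R` grows at most like the `k`-th power of its
linearisation, where `k` is its degree. -/
theorem le_tangent_pow (R : Finset ι) (L : List (ι → ℝ)) (hL : ∀ c ∈ L, ∀ i, 0 < c i) (k : ℕ)
    (hk : R.card = L.length + (k + 1)) (a w : ι → ℝ) (ha : ∀ i, 0 < a i) (hw : ∀ i, 0 < w i)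
    (t : ℝ) (ht : 0 ≤ t) :
    mixedDeriv L R (w + t • a) ≤ mixedDeriv L R w *
      (1 + t * mixedDeriv (a :: L) R w / ((k + 1) * mixedDeriv L R w)) ^ (k + 1) := by
  have haL : ∀ c ∈ a :: L, ∀ i, 0 < c i := by
    intro c hc
    rcases List.mem_cons.mp hc with rfl | hc
    exacts [ha, hL c hc]
  have hf : ∀ u : ι → ℝ, (∀ i, 0 < u i) → 0 < mixedDeriv L R u :=
    fun u hu => pos L hL R u hu (by omega)
  have hf' : ∀ u : ι → ℝ, (∀ i, 0 < u i) → 0 < mixedDeriv (a :: L) R u :=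
    fun u hu => pos _ haL R u hu (by simp only [List.length_cons]; omega)
  have hline : ∀ s : ℝ, 0 ≤ s → ∀ i, 0 < (w + s • a) i := fun s hs i => by
    simp only [Pi.add_apply, Pi.smul_apply, smul_eq_mul]
    have := mul_nonneg hs (ha i).le
    linarith [hw i]
  set h := mixedDeriv L R w / mixedDeriv (a :: L) R w with hh
  have hhpos : 0 < h := div_pos (hf w hw) (hf' w hw)
  -- Superadditivity at `w` and `s • a`; by Euler the second quotient is `s / (k + 1)`.
  have hratio : ∀ s : ℝ, 0 < s →
      h + s / (k + 1) ≤ mixedDeriv L R (w + s • a) / mixedDeriv (a :: L) R (w + s • a) := by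
    intro s hs
    have hsa : ∀ i, 0 < (s • a) i := fun i => mul_pos hs (ha i)
    refine le_trans (add_le_add le_rfl (le_of_eq ?_))
      (div_cons_superadditive R L hL a w (s • a) ha hw hsa)
    have e := cons_self L R (s • a)
    have e2 : mixedDeriv ((s • a) :: L) R (s • a) = s * mixedDeriv (a :: L) R (s • a) := by
      simp only [cons, Finset.mul_sum, Pi.smul_apply, smul_eq_mul, mul_assoc]
    rw [e2, hk] at e
    push_cast at e
    rw [div_eq_div_iff (by positivity) (hf' _ hsa).ne']
    linarith
  -- `hratio` bounds the logarithmic derivative of the numerator by that of the denominator.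
  let g : ℝ → ℝ := fun s => mixedDeriv L R (w + s • a) / (h * (k + 1) + s) ^ (k + 1)
  have hden : ∀ s : ℝ, 0 ≤ s → 0 < h * (k + 1) + s := fun s hs => by positivity
  have hder : ∀ s : ℝ, 0 ≤ s → HasDerivAt g
      ((mixedDeriv (a :: L) R (w + s • a) * (h * (k + 1) + s) ^ (k + 1) -
        mixedDeriv L R (w + s • a) * ((k + 1) * (h * (k + 1) + s) ^ k)) /
        ((h * (k + 1) + s) ^ (k + 1)) ^ 2) s := by
    intro s hs
    have hd : HasDerivAt (fun s : ℝ => (h * (k + 1) + s) ^ (k + 1))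
        ((k + 1) * (h * (k + 1) + s) ^ k) s := by
      simpa using ((hasDerivAt_id s).const_add (h * ((k : ℝ) + 1))).fun_pow (k + 1)
    exact (hasDerivAt L R w a s).fun_div hd (pow_pos (hden s hs) _).ne'
  have hanti : AntitoneOn g (Set.Ici 0) := by
    refine antitoneOn_of_deriv_nonpos (convex_Ici 0)
      (fun s hs => (hder s hs).continuousAt.continuousWithinAt)
      (fun s hs => ?_) (fun s hs => ?_)
    · rw [interior_Ici] at hs
      exact (hder s (le_of_lt hs)).differentiableAt.differentiableWithinAt
    · rw [interior_Ici] at hs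
      have hs' : 0 < s := hs
      rw [(hder s hs'.le).deriv]
      refine div_nonpos_of_nonpos_of_nonneg ?_ (by positivity)
      have hr := hratio s hs'
      rw [le_div_iff₀ (hf' _ (hline s hs'.le))] at hr
      have hp := pow_pos (hden s hs'.le) k
      have e : mixedDeriv (a :: L) R (w + s • a) * (h * (k + 1) + s) ^ (k + 1) -
          mixedDeriv L R (w + s • a) * ((k + 1) * (h * (k + 1) + s) ^ k) =
          (h * (k + 1) + s) ^ k * ((k + 1) *
          ((h + s / (k + 1)) * mixedDeriv (a :: L) R (w + s • a) - mixedDeriv L R (w + s • a))) := by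
        field_simp
        ring
      rw [e]
      exact mul_nonpos_of_nonneg_of_nonpos hp.le
        (mul_nonpos_of_nonneg_of_nonpos (by positivity) (by linarith))
  have hfin := hanti (Set.mem_Ici.mpr le_rfl) (Set.mem_Ici.mpr ht) ht
  simp only [g, zero_smul, add_zero] at hfin
  rw [div_le_iff₀ (pow_pos (hden t ht) _), div_mul_eq_mul_div, mul_div_assoc, ← div_pow] at hfin
  refine hfin.trans (le_of_eq ?_)
  have := (hf w hw).ne'
  have := (hf' w hw).ne'
  congr 2
  rw [hh]
  field_simp

/-- Lower bound for the directional derivative by the linear growth rate. -/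
theorem cons_ge_of_linear_le (R : Finset ι) (L : List (ι → ℝ)) (hL : ∀ c ∈ L, ∀ i, 0 < c i)
    (k : ℕ) (hk : R.card = L.length + (k + 2)) (a w : ι → ℝ) (ha : ∀ i, 0 < a i)
    (hw : ∀ i, 0 < w i) (C : ℝ) (hC : ∀ t : ℝ, 0 < t → C * t ≤ mixedDeriv L R (w + t • a)) :
    C * (((k : ℝ) + 1) / (k + 2)) ^ (k + 1) ≤ mixedDeriv (a :: L) R w := by
  have hf : 0 < mixedDeriv L R w := pos L hL R w hw (by omega)
  have hf' : 0 < mixedDeriv (a :: L) R w := by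
    refine pos _ ?_ R w hw (by simp only [List.length_cons]; omega)
    intro c hc
    rcases List.mem_cons.mp hc with rfl | hc
    exacts [ha, hL c hc]
  set f := mixedDeriv L R w
  set f' := mixedDeriv (a :: L) R w
  -- Minimiser of the tangent-power bound divided by `t`.
  set t := (k + 2) * f / ((k + 1) * f') with ht
  have htpos : 0 < t := by positivity
  have h := (hC t htpos).trans (le_tangent_pow R L hL (k + 1) hk a w ha hw t htpos.le)
  change C * t ≤ f * (1 + t * f' / (((k + 1 : ℕ) + 1) * f)) ^ (k + 2) at h
  have e : 1 + t * f' / (((k + 1 : ℕ) + 1) * f) = ((k : ℝ) + 2) / (k + 1) := by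
    rw [ht]
    push_cast
    field_simp
    ring
  rw [e, ← mul_le_mul_iff_left₀
    (show 0 < f' / f * (((k : ℝ) + 1) / (k + 2)) ^ (k + 2) by positivity)] at h
  have e1 : C * t * (f' / f * (((k : ℝ) + 1) / (k + 2)) ^ (k + 2)) =
      C * (((k : ℝ) + 1) / (k + 2)) ^ (k + 1) := by
    rw [ht, pow_succ _ (k + 1)]
    field_simp
  have e2 : f * (((k : ℝ) + 2) / (k + 1)) ^ (k + 2) * (f' / f * (((k : ℝ) + 1) / (k + 2)) ^ (k + 2))
      = f' := by
    have : (((k : ℝ) + 2) / (k + 1)) ^ (k + 2) * (((k : ℝ) + 1) / (k + 2)) ^ (k + 2) = 1 := by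
      rw [← mul_pow]
      field_simp
      simp
    calc _ = f * (f' / f) * ((((k : ℝ) + 2) / (k + 1)) ^ (k + 2) *
          (((k : ℝ) + 1) / (k + 2)) ^ (k + 2)) := by ring
      _ = f' := by rw [this]; field_simp
  rwa [e1, e2] at h

/-- Capacity bound for mixed derivatives. -/
theorem capacity_le (R : Finset ι) (k : ℕ) (c : Fin k → ι → ℝ) (hc : ∀ j i, 0 < c j i)
    (L : List (ι → ℝ)) (hL : ∀ c ∈ L, ∀ i, 0 < c i) (hk : R.card = L.length + k) (C : ℝ)
    (hC : ∀ x : Fin k → ℝ, (∀ j, 0 < x j) →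
      C * ∏ j, x j ≤ mixedDeriv L R (∑ j, x j • c j)) :
    (k ! : ℝ) / (k : ℝ) ^ k * C ≤ mixedDeriv (List.ofFn c ++ L) R 0 := by
  induction k generalizing L C with
  | zero => simpa using hC 0 (by simp)
  | succ k ih =>
    have hp : (List.ofFn c ++ L).Perm (List.ofFn (fun j : Fin k => c j.succ) ++ c 0 :: L) := by
      rw [List.ofFn_succ, List.cons_append]
      exact List.perm_middle.symm
    rw [perm hp]
    have hL' : ∀ d ∈ c 0 :: L, ∀ i, 0 < d i := by
      intro d hd
      rcases List.mem_cons.mp hd with rfl | hd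
      exacts [hc 0, hL d hd]
    have hcoef : ((k + 1)! : ℝ) / ((k + 1 : ℕ) : ℝ) ^ (k + 1) * C =
        (k ! : ℝ) / (k : ℝ) ^ k * (C * ((k : ℝ) / (k + 1)) ^ k) := by
      rcases Nat.eq_zero_or_pos k with rfl | hk0
      · simp
      · have : (0 : ℝ) < k := by exact_mod_cast hk0
        rw [Nat.factorial_succ]
        push_cast
        rw [div_pow]
        field_simp
        ring
    rw [hcoef]
    refine ih (fun j => c j.succ) (fun j => hc j.succ) (c 0 :: L) hL'
      (by simp only [List.length_cons]; omega) _ fun x hx => ?_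
    set w := ∑ j, x j • c j.succ with hw
    have hC' : ∀ t : ℝ, 0 < t → C * (∏ j, x j) * t ≤ mixedDeriv L R (w + t • c 0) := by
      intro t ht
      have := hC (Fin.cons t x) (fun j => by
        refine Fin.cases ?_ (fun j => ?_) j
        · simpa using ht
        · simpa using hx j)
      rw [Fin.prod_univ_succ, Fin.sum_univ_succ] at this
      simp only [Fin.cons_zero, Fin.cons_succ] at this
      rw [add_comm w]
      refine le_trans (le_of_eq ?_) this
      ring
    -- At the last vector `w = 0` is not positive, but f is linear and equals its derivative along
    -- `c 0` there: nothing is lost.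
    cases k with
    | zero =>
      have h1 := hC' 1 one_pos
      have hw0 : w = 0 := by simp [hw]
      have e := cons_self L R (c 0)
      rw [hk] at e
      rw [congr_of_card_le _ _ w (c 0) (by simp only [List.length_cons]; omega), e]
      simp only [hw0, one_smul, zero_add, mul_one] at h1
      simpa using h1
    | succ k =>
      have hwpos : ∀ i, 0 < w i := fun i => by
        rw [hw, Finset.sum_apply]
        exact Finset.sum_pos (fun j _ => mul_pos (hx j) (hc _ i)) Finset.univ_nonempty
      refine le_trans (le_of_eq ?_)
        (cons_ge_of_linear_le R L hL k hk (c 0) w (hc 0) hwpos _ hC')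
      push_cast
      rw [add_assoc, one_add_one_eq_two]
      ring

/-! ### Full mixed derivatives as permanents -/

theorem ofFn_one (k : ℕ) (c : Fin k → ι → ℝ) [Fintype ι] (R : Finset ι) :
    mixedDeriv (List.ofFn c) R 1 = ∑ f : Fin k → ι,
      if Function.Injective f ∧ ∀ j, f j ∈ R then ∏ j, c j (f j) else 0 := by
  induction k generalizing R with
  | zero => simp [nil, Function.injective_of_subsingleton]
  | succ k ih =>
    rw [List.ofFn_succ, cons, ← (Fin.consEquiv fun _ => ι).sum_comp, Fintype.sum_prod_type,
      ← Finset.sum_subset (Finset.subset_univ R)]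
    · refine Finset.sum_congr rfl fun i hi => ?_
      rw [ih, Finset.mul_sum]
      refine Finset.sum_congr rfl fun f _ => ?_
      have : (Function.Injective (Fin.cons i f : Fin (k + 1) → ι) ∧
          ∀ j, (Fin.cons i f : Fin (k + 1) → ι) j ∈ R) ↔
          (Function.Injective f ∧ ∀ j, f j ∈ R.erase i) := by
        rw [Fin.cons_injective_iff, Fin.forall_fin_succ]
        simp only [Fin.cons_zero, Fin.cons_succ, Finset.mem_erase, Set.mem_range, not_exists]
        constructor
        · rintro ⟨⟨h1, h2⟩, _, h4⟩
          exact ⟨h2, fun j => ⟨h1 j, h4 j⟩⟩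
        · rintro ⟨h1, h2⟩
          exact ⟨⟨fun j => (h2 j).1, h1⟩, hi, fun j => (h2 j).2⟩
      change _ = if Function.Injective (Fin.cons i f : Fin (k + 1) → ι) ∧
          ∀ j, (Fin.cons i f : Fin (k + 1) → ι) j ∈ R then
          ∏ j, c j ((Fin.cons i f : Fin (k + 1) → ι) j) else 0
      simp only [this, mul_ite, mul_zero, Fin.prod_univ_succ, Fin.cons_zero, Fin.cons_succ]
    · intro i _ hi
      refine Finset.sum_eq_zero fun f _ => if_neg ?_
      rintro ⟨_, h⟩
      exact hi (by simpa using h 0)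

theorem ofFn_col_eq_permanent {N : ℕ} (A : Matrix (Fin N) (Fin N) ℝ) (v : Fin N → ℝ) :
    mixedDeriv (List.ofFn fun j i => A i j) Finset.univ v = A.permanent := by
  rw [congr_of_card_le _ _ v 1 (by simp), ofFn_one, Matrix.permanent]
  simp only [Finset.mem_univ, implies_true, and_true]
  rw [← Finset.sum_filter]
  symm
  refine Finset.sum_bij (fun σ _ => ⇑σ) (fun σ _ => by simp [σ.injective])
    (fun σ _ τ _ h => DFunLike.coe_injective h) (fun f hf => ?_) (fun σ _ => rfl)
  have hf' : Function.Injective f := by simpa using hf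
  exact ⟨Equiv.ofBijective f (Finite.injective_iff_bijective.mp hf'), Finset.mem_univ _, rfl⟩

end mixedDeriv

namespace Matrix

theorem capacity_le_permanent_of_pos {N : ℕ} (A : Matrix (Fin N) (Fin N) ℝ)
    (hA : ∀ i j, 0 < A i j) (C : ℝ)
    (hC : ∀ x : Fin N → ℝ, (∀ j, 0 < x j) → C * ∏ j, x j ≤ ∏ i, ∑ j, A i j * x j) :
    (N ! : ℝ) / (N : ℝ) ^ N * C ≤ A.permanent := by
  have := mixedDeriv.capacity_le Finset.univ N (fun j i => A i j) (fun j i => hA i j) []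
    (by simp) (by simp) C fun x hx => by
      refine (hC x hx).trans (le_of_eq ?_)
      simp [mixedDeriv.nil, Finset.sum_apply, mul_comm]
  rwa [List.append_nil, mixedDeriv.ofFn_col_eq_permanent] at this

/-- Gurvits' capacity bound for permanents of nonnegative matrices. -/
theorem capacity_le_permanent {N : ℕ} (A : Matrix (Fin N) (Fin N) ℝ)
    (hA : ∀ i j, 0 ≤ A i j) (C : ℝ)
    (hC : ∀ x : Fin N → ℝ, (∀ j, 0 < x j) → C * ∏ j, x j ≤ ∏ i, ∑ j, A i j * x j) :
    (N ! : ℝ) / (N : ℝ) ^ N * C ≤ A.permanent := by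
  -- Adding `ε` to every entry makes the matrix positive and keeps the capacity hypothesis; then ε →
  -- 0.
  let F : ℝ → ℝ := fun ε => (Matrix.of fun i j => A i j + ε).permanent
  have hF : Continuous F := by
    simp only [F, Matrix.permanent, Matrix.of_apply]
    fun_prop
  have hF0 : F 0 = A.permanent := by
    simp only [F, add_zero]
    rfl
  rw [← hF0]
  refine ge_of_tendsto ((hF.tendsto 0).mono_left (nhdsWithin_le_nhds (s := Set.Ioi 0))) ?_
  filter_upwards [self_mem_nhdsWithin] with ε hε
  have hε' : 0 < ε := hε
  refine capacity_le_permanent_of_pos _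
    (fun i j => by simpa using add_pos_of_nonneg_of_pos (hA i j) hε') C
    fun x hx => (hC x hx).trans ?_
  refine Finset.prod_le_prod
    (fun i _ => Finset.sum_nonneg fun j _ => mul_nonneg (hA i j) (hx j).le)
    fun i _ => Finset.sum_le_sum fun j _ => ?_
  exact mul_le_mul_of_nonneg_right (by simpa using hε'.le) (hx j).le

end Matrix

/-! ### Capacity of β.*(1-β) -/

theorem doublyStochastic_permanent_beliefVariance_ge {N : ℕ} (β : Matrix (Fin N) (Fin N) ℝ)
    (hβ : β ∈ doublyStochastic ℝ (Fin N)) :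
    (N ! : ℝ) / (N : ℝ) ^ N * ∏ i, ∏ j, (1 - β i j) ^ β i j ≤ (beliefVariance β).permanent := by
  obtain ⟨h0, hrow, hcol⟩ := mem_doublyStochastic_iff_sum.mp hβ
  have h1 : ∀ i j, 0 ≤ 1 - β i j := fun i j => sub_nonneg.mpr <|
    (Finset.single_le_sum (fun k _ => h0 i k) (Finset.mem_univ j)).trans_eq (hrow i)
  refine Matrix.capacity_le_permanent _ (fun i j => mul_nonneg (h0 i j) (h1 i j)) _ fun x hx => ?_
  calc (∏ i, ∏ j, (1 - β i j) ^ β i j) * ∏ j, x j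
      = ∏ i, ∏ j, ((1 - β i j) * x j) ^ β i j := by
        simp only [Real.mul_rpow (h1 _ _) (hx _).le, Finset.prod_mul_distrib]
        congr 1
        rw [Finset.prod_comm]
        refine Finset.prod_congr rfl fun j _ => ?_
        -- Column sums enter here, row sums as the AM-GM weights below.
        rw [← Real.rpow_sum_of_pos (hx j), hcol j, Real.rpow_one]
    _ ≤ ∏ i, ∑ j, beliefVariance β i j * x j := by
        refine Finset.prod_le_prod (fun i _ => Finset.prod_nonneg fun j _ =>
          Real.rpow_nonneg (mul_nonneg (h1 i j) (hx j).le) _) fun i _ => ?_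
        refine (Real.geom_mean_le_arith_mean_weighted Finset.univ (β i)
          (fun j => (1 - β i j) * x j) (fun j _ => h0 i j) (hrow i)
          (fun j _ => mul_nonneg (h1 i j) (hx j).le)).trans (le_of_eq ?_)
        exact Finset.sum_congr rfl fun j _ => (mul_assoc _ _ _).symm

theorem corollary1 (N : ℕ) :
    (∀ (p : Matrix (Fin N) (Fin N) ℝ) (T : ℝ) (β : Matrix (Fin N) (Fin N) ℝ),
      (∀ i j, 0 ≤ p i j) → 0 < T → IsBPBelief p T β →
        (N ! : ℝ) / (N : ℝ) ^ N * ∏ i, ∏ j, (1 - β i j) ^ β i j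
          ≤ (beliefVariance β).permanent) ∧
    (∀ β ∈ doublyStochastic ℝ (Fin N),
        (N ! : ℝ) / (N : ℝ) ^ N * ∏ i, ∏ j, (1 - β i j) ^ β i j
          ≤ (beliefVariance β).permanent) := by
  exact ⟨fun _ _ β _ _ h => doublyStochastic_permanent_beliefVariance_ge β h.doublyStochastic,
    fun β hβ => doublyStochastic_permanent_beliefVariance_ge β hβ⟩
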